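/- A binary prefix code for a countable alphabet $A$ is a map $C : A \to \{0,1\}^*$ such that for distinct $a, b \in A$ the word $C(a)$ is not a prefix of $C(b)$ (on a one-symbol alphabet the empty codeword is allowed). Given nonnegative weights $w$ on $A$, the cost of $C$ is $\sum_{a \in A} w(a)\,|C(a)| \in [0,\infty]$, where $|C(a)|$ is the length of $C(a)$, and a binary prefix code is called optimal for $(A,w)$ if its cost is at most the cost of every binary prefix code for $A$. For $0<q<1$, let $\mathrm{TDGD}(q)$ be the probability distribution $P(i,j) = (1-q)^2 q^{i+j}$ on pairs $(i,j)$ of integers $i,j \ge 0$, and let $G_1$ be the unary code, $G_1(n) = 1^n 0$ for integers $n \ge 0$. Theorem. Let $k \ge 1$ be an integer and $q = 2^{-1/k}$. The finite source $A_k = \{(i,j) : 0 \le i,j < k\}$ with weights $w(i,j) = q^{i+j}$ has an optimal binary prefix code, and for every optimal binary prefix code $T_k$ for this source, the code $$C_k(i,j) = T_k(i \bmod k,\; j \bmod k)\cdot G_1\!\left(\left\lfloor \tfrac{i}{k}\right\rfloor\right)\cdot G_1\!\left(\left\lfloor \tfrac{j}{k}\right\rfloor\right), \qquad i,j \ge 0,$$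 where $\cdot$ denotes concatenation of words, is an optimal binary prefix code for $\mathrm{TDGD}(q)$. -/

import Mathlib

open scoped ENNReal

namespace TDGDCode

/-- A binary prefix code for the alphabet `α` (given by its encoding map): the codeword of one
symbol is never a prefix of the codeword of a different symbol; in particular the map is
injective. As usual, on a one-symbol alphabet the empty word is allowed as a codeword. -/
def IsPrefixCode {α : Type*} (C : α → List Bool) : Prop :=
  ∀ a b : α, C a <+: C b → a = b

/-- The cost (weighted total codeword length) `∑ w(a) |C(a)|` of `C`, for a nonnegative weight `w`,
as a value in `[0, ∞]`. It is the average code length when `w` is a probability distribution. -/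
noncomputable def cost {α : Type*} (w : α → ℝ) (C : α → List Bool) : ℝ≥0∞ :=
  ∑' a, ENNReal.ofReal (w a) * ((C a).length : ℝ≥0∞)

/-- `C` is an optimal prefix code for the source with nonnegative weights `w`. -/
structure IsOptimalCode {α : Type*} (w : α → ℝ) (C : α → List Bool) : Prop where
  isPrefixCode : IsPrefixCode C
  cost_le : ∀ C' : α → List Bool, IsPrefixCode C' → cost w C ≤ cost w C'

/-- The geometric distribution `p(i) = (1 - q) q ^ i` on the nonnegative integers. -/
def geom (q : ℝ) (i : ℕ) : ℝ := (1 - q) * q ^ i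

/-- The two-dimensional geometric distribution `P(i, j) = p(i) p(j) = (1 - q)² q ^ (i + j)`. -/
def tdgd (q : ℝ) (x : ℕ × ℕ) : ℝ := geom q x.1 * geom q x.2

/-- The weights `w(i, j) = q ^ (i + j)` of the finite source `{(i, j) | 0 ≤ i, j < k}`. -/
def topWeight (q : ℝ) (k : ℕ) (x : Fin k × Fin k) : ℝ := q ^ ((x.1 : ℕ) + (x.2 : ℕ))

/-- The unary code: `n` is encoded as `n` ones followed by a zero. -/
def unary (n : ℕ) : List Bool := List.replicate n true ++ [false]

/-- The code `(i, j) ↦ T(i mod k, j mod k) · G₁(⌊i/k⌋) · G₁(⌊j/k⌋)` with top code `T`. -/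
def blockCode (k : ℕ) (hk : 1 ≤ k) (T : Fin k × Fin k → List Bool) (x : ℕ × ℕ) : List Bool :=
  T (⟨x.1 % k, Nat.mod_lt x.1 hk⟩, ⟨x.2 % k, Nat.mod_lt x.2 hk⟩) ++
    unary (x.1 / k) ++ unary (x.2 / k)

end TDGDCode

namespace TDGDCode

/-! The proof is Lagrangian duality for Kraft's inequality. If lengths `l` have Kraft sum exactly
one and, for a single multiplier `c`, satisfy `w a ≤ c * 2⁻ˡ ≤ 2 * w a` at every symbol, then `l a`
minimizes `w a * n + c * 2⁻ⁿ` over `n`. Summing over `a` shows that no prefix code is cheaper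
(`tsum_le_cost_of_lagrangian`, `lagrangian_le`).

Since `q ^ k = 1/2`, with `c = q⁻ᵗ` this sandwich on the finite source reads `k * L r ≤ r.1 + r.2 +
t ≤ k * L r + k`. The main work is to find such `L` with Kraft sum one
(`exists_lengths_kraft_eq_one`).

A block step in either coordinate halves the weight and adds one bit, so the sandwich and the Kraft
equality pass from `L` to the infinite source. The cost of a block code depends on its top code only
through the top cost (`tsum_block_eq`), so every optimal top code does as well as `L`. -/

/-! ### Kraft's inequality and its converse -/

/-- The words of length `n` that extend the word `c`, when `c` has length at most `n`. -/
def extensions (n : ℕ) (c : List Bool) : Finset (List Bool) :=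
  (Finset.univ : Finset (List.Vector Bool (n - c.length))).image fun v => c ++ v.toList

lemma card_extensions (n : ℕ) (c : List Bool) :
    (extensions n c).card = 2 ^ (n - c.length) := by
  rw [extensions, Finset.card_image_of_injective]
  · simp [card_vector]
  · intro u v h
    exact List.Vector.toList_injective (List.append_cancel_left h)

lemma mem_extensions {n : ℕ} {c x : List Bool} (hc : c.length ≤ n) :
    x ∈ extensions n c ↔ x.length = n ∧ c <+: x := by
  simp only [extensions, Finset.mem_image, Finset.mem_univ, true_and]
  constructor
  · rintro ⟨v, rfl⟩
    exact ⟨by simp; omega, List.prefix_append _ _⟩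
  · rintro ⟨hx, y, rfl⟩
    exact ⟨⟨y, by simp at hx; omega⟩, rfl⟩

lemma extensions_subset {n : ℕ} {c : List Bool} (hc : c.length ≤ n) :
    extensions n c ⊆ extensions n [] := by
  intro x hx
  rw [mem_extensions hc] at hx
  rw [mem_extensions (by simp)]
  exact ⟨hx.1, List.nil_prefix⟩

/-- **Kraft's inequality** for finite subsets of a prefix code. -/
lemma IsPrefixCode.sum_le_one {α : Type*} {C : α → List Bool} (hC : IsPrefixCode C)
    (s : Finset α) : ∑ a ∈ s, (2⁻¹ : ℝ) ^ (C a).length ≤ 1 := by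
  classical
  set n := s.sup fun a => (C a).length
  have hn : ∀ a ∈ s, (C a).length ≤ n := fun a ha =>
    Finset.le_sup (f := fun a => (C a).length) ha
  -- Two prefixes of one word are comparable, so a common extension would make one codeword a prefix
  -- of another.
  have hdisj : (s : Set α).PairwiseDisjoint fun a => extensions n (C a) := by
    intro a ha b hb hab
    refine Finset.disjoint_left.2 fun x hxa hxb => hab ?_
    rw [mem_extensions (hn a ha)] at hxa
    rw [mem_extensions (hn b hb)] at hxb
    rcases List.prefix_or_prefix_of_prefix hxa.2 hxb.2 with h | h
    · exact hC a b h
    · exact (hC b a h).symm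
  have hcard : ∑ a ∈ s, 2 ^ (n - (C a).length) ≤ 2 ^ n := by
    have h := Finset.card_le_card
      (Finset.biUnion_subset.2 fun a ha => extensions_subset (hn a ha))
    rw [Finset.card_biUnion hdisj] at h
    simpa [card_extensions] using h
  have hpos : (0 : ℝ) < 2 ^ n := by positivity
  rw [← mul_le_mul_iff_right₀ hpos, Finset.mul_sum, mul_one]
  calc ∑ a ∈ s, (2 : ℝ) ^ n * 2⁻¹ ^ (C a).length
      = ∑ a ∈ s, (2 : ℝ) ^ (n - (C a).length) :=
        Finset.sum_congr rfl fun a ha => by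
          rw [pow_sub₀ _ two_ne_zero (hn a ha), inv_pow]
    _ ≤ 2 ^ n := by exact_mod_cast hcard

/-- **Kraft's inequality** for countable prefix codes. -/
lemma IsPrefixCode.tsum_le_one {α : Type*} {C : α → List Bool} (hC : IsPrefixCode C) :
    ∑' a, ENNReal.ofReal ((2⁻¹ : ℝ) ^ (C a).length) ≤ 1 := by
  rw [ENNReal.tsum_eq_iSup_sum]
  refine iSup_le fun s => ?_
  rw [← ENNReal.ofReal_sum_of_nonneg fun _ _ => by positivity]
  exact ENNReal.ofReal_le_one.2 (hC.sum_le_one s)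

/-- The converse of Kraft's inequality for finite alphabets. -/
lemma exists_isPrefixCode_length_eq {α : Type*} [Fintype α] (l : α → ℕ)
    (hl : ∑ a, (2⁻¹ : ℝ) ^ l a ≤ 1) :
    ∃ C : α → List Bool, IsPrefixCode C ∧ ∀ a, (C a).length = l a := by
  classical
  suffices h : ∀ s : Finset α, ∑ a ∈ s, (2⁻¹ : ℝ) ^ l a ≤ 1 →
      ∃ C : α → List Bool, (∀ a ∈ s, ∀ b ∈ s, C a <+: C b → a = b) ∧
        ∀ a ∈ s, (C a).length = l a by
    obtain ⟨C, h1, h2⟩ := h Finset.univ hl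
    exact ⟨C, fun a b => h1 a (Finset.mem_univ a) b (Finset.mem_univ b),
      fun a => h2 a (Finset.mem_univ a)⟩
  intro s
  -- Symbols enter in order of increasing length, so each earlier codeword blocks `2 ^ (l a - l b)`
  -- words of length `l a`. The Kraft sum of the earlier ones is strictly below one, which leaves a
  -- free word.
  induction s using Finset.induction_on_max_value l with
  | empty => exact fun _ => ⟨fun _ => [], by simp, by simp⟩
  | insert a s ha hmax ih =>
    intro hs
    rw [Finset.sum_insert ha] at hs
    have hpos : (0 : ℝ) < 2⁻¹ ^ l a := by positivity
    obtain ⟨C, hpre, hlen⟩ := ih (by linarith)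
    have hle : ∀ b ∈ s, (C b).length ≤ l a := fun b hb => (hlen b hb).trans_le (hmax b hb)
    have hsum : ∑ b ∈ s, (2 : ℝ) ^ (l a - (C b).length) < 2 ^ l a := by
      calc ∑ b ∈ s, (2 : ℝ) ^ (l a - (C b).length)
          = 2 ^ l a * ∑ b ∈ s, (2⁻¹ : ℝ) ^ l b := by
            rw [Finset.mul_sum]
            refine Finset.sum_congr rfl fun b hb => ?_
            rw [pow_sub₀ _ two_ne_zero (hle b hb), inv_pow, hlen b hb]
        _ < 2 ^ l a * 1 := mul_lt_mul_of_pos_left (by linarith) (by positivity)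
        _ = 2 ^ l a := mul_one _
    have hcard : (s.biUnion fun b => extensions (l a) (C b)).card
        < (extensions (l a) []).card := by
      refine Finset.card_biUnion_le.trans_lt ?_
      simp only [card_extensions, List.length_nil, tsub_zero]
      exact_mod_cast hsum
    obtain ⟨x, hx, hxn⟩ := Finset.exists_mem_notMem_of_card_lt_card hcard
    have hxl : x.length = l a := ((mem_extensions (by simp)).1 hx).1
    have hxs : ∀ b ∈ s, ¬ C b <+: x := fun b hb h =>
      hxn (Finset.mem_biUnion.2 ⟨b, hb, (mem_extensions (hle b hb)).2 ⟨hxl, h⟩⟩)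
    have hne : ∀ b ∈ s, b ≠ a := fun b hb h => ha (h ▸ hb)
    refine ⟨Function.update C a x, ?_, ?_⟩
    · intro b hb c hc hbc
      rcases Finset.mem_insert.1 hb with rfl | hb' <;> rcases Finset.mem_insert.1 hc with rfl | hc'
      · rfl
      · rw [Function.update_self, Function.update_of_ne (hne c hc')] at hbc
        have heq := hbc.eq_of_length_le (by rw [hxl]; exact hle c hc')
        exact absurd (heq ▸ List.prefix_refl _) (hxs c hc')
      · rw [Function.update_self, Function.update_of_ne (hne b hb')] at hbc
        exact absurd hbc (hxs b hb')
      · rw [Function.update_of_ne (hne b hb'), Function.update_of_ne (hne c hc')] at hbc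
        exact hpre b hb' c hc' hbc
    · intro b hb
      rcases Finset.mem_insert.1 hb with rfl | hb
      · rwa [Function.update_self]
      · rw [Function.update_of_ne (hne b hb), hlen b hb]

/-! ### Optimality by Lagrangian duality -/

/-- Weak Lagrangian duality: lengths that satisfy Kraft's inequality with equality and minimize
`w a * n + c * 2⁻ⁿ` for every symbol `a` are at least as cheap as every prefix code. -/
lemma tsum_le_cost_of_lagrangian {α : Type*} {w : α → ℝ} (hw : ∀ a, 0 ≤ w a) {l : α → ℕ} {c : ℝ}
    (hc : 0 ≤ c) (hl : ∑' a, ENNReal.ofReal ((2⁻¹ : ℝ) ^ l a) = 1)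
    (hmin : ∀ a (n : ℕ), w a * l a + c * 2⁻¹ ^ l a ≤ w a * n + c * 2⁻¹ ^ n)
    {C : α → List Bool} (hC : IsPrefixCode C) :
    ∑' a, ENNReal.ofReal (w a) * (l a : ℝ≥0∞) ≤ cost w C := by
  have hsplit : ∀ a (n : ℕ), ENNReal.ofReal (w a * n + c * 2⁻¹ ^ n) =
      ENNReal.ofReal (w a) * (n : ℝ≥0∞) + ENNReal.ofReal c * ENNReal.ofReal (2⁻¹ ^ n) := by
    intro a n
    rw [ENNReal.ofReal_add (mul_nonneg (hw a) (Nat.cast_nonneg n)) (by positivity),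
      ENNReal.ofReal_mul (hw a), ENNReal.ofReal_natCast, ENNReal.ofReal_mul hc]
  -- The added term is finite, so it cancels even when a cost is infinite.
  have h : ∑' a, ENNReal.ofReal (w a) * (l a : ℝ≥0∞) + ENNReal.ofReal c * 1 ≤
      cost w C + ENNReal.ofReal c * 1 := by
    calc ∑' a, ENNReal.ofReal (w a) * (l a : ℝ≥0∞) + ENNReal.ofReal c * 1
        = ∑' a, ENNReal.ofReal (w a * l a + c * 2⁻¹ ^ l a) := by
          simp_rw [hsplit]
          rw [ENNReal.tsum_add, ENNReal.tsum_mul_left, hl]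
      _ ≤ ∑' a, ENNReal.ofReal (w a * (C a).length + c * 2⁻¹ ^ (C a).length) :=
          ENNReal.tsum_le_tsum fun a => ENNReal.ofReal_le_ofReal (hmin a _)
      _ = cost w C + ENNReal.ofReal c * ∑' a, ENNReal.ofReal (2⁻¹ ^ (C a).length) := by
          simp_rw [hsplit]
          rw [ENNReal.tsum_add, ENNReal.tsum_mul_left, cost]
      _ ≤ cost w C + ENNReal.ofReal c * 1 := by gcongr; exact hC.tsum_le_one
  exact (ENNReal.add_le_add_iff_right (by simp)).1 h

/-- The function `n ↦ w * n + c * 2⁻ⁿ` is minimal at `l` as soon as `w ≤ c * 2⁻ˡ ≤ 2 * w`. -/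
lemma lagrangian_le {w c : ℝ} {l : ℕ} (hw : 0 ≤ w) (h1 : w ≤ c * 2⁻¹ ^ l)
    (h2 : c * 2⁻¹ ^ l ≤ 2 * w) (n : ℕ) :
    w * l + c * 2⁻¹ ^ l ≤ w * n + c * 2⁻¹ ^ n := by
  -- Lengthening by `m` saves `c * 2⁻ˡ * (1 - 2⁻ᵐ) ≤ w * m`, by Bernoulli and `h2`; shortening by
  -- `m` saves `w * m ≤ c * 2⁻ˡ * (2ᵐ - 1)`, by `h1`.
  rcases le_total l n with h | h
  · obtain ⟨m, rfl⟩ := Nat.exists_eq_add_of_le h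
    have hm : 1 - (2⁻¹ : ℝ) ^ m ≤ m / 2 := by
      have := one_add_mul_le_pow (a := (-2⁻¹ : ℝ)) (by norm_num) m
      norm_num at this ⊢
      linarith
    have hm0 : (0 : ℝ) ≤ 1 - 2⁻¹ ^ m := sub_nonneg.2 (pow_le_one₀ (by norm_num) (by norm_num))
    have := mul_le_mul_of_nonneg_right h2 hm0
    have := mul_le_mul_of_nonneg_left hm (by positivity : 0 ≤ 2 * w)
    push_cast
    rw [pow_add]
    nlinarith
  · obtain ⟨m, rfl⟩ := Nat.exists_eq_add_of_le h
    have hm : (m : ℝ) ≤ 2 ^ m - 1 := by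
      have : m + 1 ≤ 2 ^ m := Nat.lt_two_pow_self
      have : (m : ℝ) + 1 ≤ 2 ^ m := by exact_mod_cast this
      linarith
    have hc : c * 2⁻¹ ^ n = c * 2⁻¹ ^ (n + m) * 2 ^ m := by
      rw [pow_add, mul_assoc, mul_assoc, ← mul_pow]
      norm_num
    have hm0 : (0 : ℝ) ≤ m := Nat.cast_nonneg m
    have := mul_le_mul_of_nonneg_right h1 (hm0.trans hm)
    have := mul_le_mul_of_nonneg_left hm hw
    rw [hc]
    push_cast
    nlinarith

/-! ### Subset sums of ones and twos -/

/-- Every number up to a sum of ones and twos is a subsum, unless it is odd and there are only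
twos. -/
lemma exists_subset_sum_eq {ι : Type*} {D : Finset ι} {f : ι → ℕ}
    (hf : ∀ i ∈ D, f i = 1 ∨ f i = 2) {m : ℕ} (hm : m ≤ ∑ i ∈ D, f i)
    (hodd : Odd m → ∃ i ∈ D, f i = 1) : ∃ B ⊆ D, ∑ i ∈ B, f i = m := by
  classical
  have hdisj : Disjoint (D.filter fun i => f i = 1) (D.filter fun i => f i = 2) :=
    Finset.disjoint_filter.2 fun i _ h => by omega
  have hunion : (D.filter fun i => f i = 1) ∪ (D.filter fun i => f i = 2) = D := by
    rw [← Finset.filter_or]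
    exact Finset.filter_true_of_mem hf
  have h1 : ∀ B ⊆ D.filter fun i => f i = 1, ∑ i ∈ B, f i = B.card := by
    intro B hB
    rw [Finset.sum_congr rfl fun i hi => (Finset.mem_filter.1 (hB hi)).2]
    simp
  have h2 : ∀ B ⊆ D.filter fun i => f i = 2, ∑ i ∈ B, f i = 2 * B.card := by
    intro B hB
    rw [Finset.sum_congr rfl fun i hi => (Finset.mem_filter.1 (hB hi)).2]
    simp [mul_comm]
  rw [← hunion, Finset.sum_union hdisj, h1 _ subset_rfl, h2 _ subset_rfl] at hm
  have hone : m % 2 = 1 → 0 < (D.filter fun i => f i = 1).card := by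
    intro h
    obtain ⟨i, hi, hfi⟩ := hodd (Nat.odd_iff.2 h)
    exact Finset.card_pos.2 ⟨i, Finset.mem_filter.2 ⟨hi, hfi⟩⟩
  -- Greedy choice: as many twos as fit, then ones. If the twos run out, `hm` supplies enough ones;
  -- otherwise at most one is needed, and `hone` supplies it.
  obtain ⟨B₂, hB₂, hc₂⟩ := Finset.exists_subset_card_eq
    (min_le_left (D.filter fun i => f i = 2).card (m / 2))
  obtain ⟨B₁, hB₁, hc₁⟩ := Finset.exists_subset_card_eq
    (show m - 2 * min (D.filter fun i => f i = 2).card (m / 2) ≤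
      (D.filter fun i => f i = 1).card by omega)
  refine ⟨B₁ ∪ B₂, ?_, ?_⟩
  · rw [← hunion]
    exact Finset.union_subset_union hB₁ hB₂
  · rw [Finset.sum_union (Finset.disjoint_of_subset_left hB₁
      (Finset.disjoint_of_subset_right hB₂ hdisj)), h1 _ hB₁, h2 _ hB₂, hc₁, hc₂]
    omega

/-! ### The block code is a prefix code -/

lemma IsPrefixCode.prod {α β : Type*} {C : α → List Bool} {D : β → List Bool}
    (hC : IsPrefixCode C) (hD : IsPrefixCode D) :
    IsPrefixCode fun x : α × β => C x.1 ++ D x.2 := by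
  rintro ⟨a, b⟩ ⟨a', b'⟩ h
  have haa : a = a' := by
    rcases List.prefix_or_prefix_of_prefix ((List.prefix_append _ _).trans h)
      (List.prefix_append (C a') (D b')) with h | h
    · exact hC _ _ h
    · exact (hC _ _ h).symm
  subst haa
  rw [hD b b' ((List.prefix_append_right_inj _).1 h)]

lemma unary_isPrefixCode : IsPrefixCode unary := by
  intro a
  induction a with
  | zero =>
    intro b h
    cases b with
    | zero => rfl
    | succ b => simp [unary, List.replicate_succ] at h
  | succ a ih =>
    intro b h
    cases b with
    | zero => simp [unary, List.replicate_succ] at h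
    | succ b =>
      simp only [unary, List.replicate_succ, List.cons_append, List.cons_prefix_cons,
        true_and] at h
      rw [ih b h]

lemma length_unary (n : ℕ) : (unary n).length = n + 1 := by simp [unary]

/-- Division with remainder by `k` in both coordinates. -/
def blockEquiv (k : ℕ) (hk : 1 ≤ k) : ℕ × ℕ ≃ ((Fin k × Fin k) × ℕ) × ℕ where
  toFun x := (((⟨x.1 % k, Nat.mod_lt x.1 hk⟩, ⟨x.2 % k, Nat.mod_lt x.2 hk⟩), x.1 / k), x.2 / k)
  invFun y := (y.1.1.1 + k * y.1.2, y.1.1.2 + k * y.2)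
  left_inv x := by simp [Nat.mod_add_div]
  right_inv y := by
    obtain ⟨⟨⟨⟨r, hr⟩, ⟨s, hs⟩⟩, a⟩, b⟩ := y
    simp [Nat.mod_eq_of_lt hr, Nat.mod_eq_of_lt hs, Nat.add_mul_div_left _ _ hk,
      Nat.div_eq_of_lt hr, Nat.div_eq_of_lt hs]

lemma blockCode_isPrefixCode {k : ℕ} (hk : 1 ≤ k) {T : Fin k × Fin k → List Bool}
    (hT : IsPrefixCode T) : IsPrefixCode (blockCode k hk T) := by
  intro x y h
  exact (blockEquiv k hk).injective
    (((hT.prod unary_isPrefixCode).prod unary_isPrefixCode) (blockEquiv k hk x)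
      (blockEquiv k hk y) h)

/-! ### Lengths for the finite source -/

/-- There are lengths `L r` on `Fin k × Fin k` with Kraft sum one and a shift `t` such that
`k * L r ≤ r.1 + r.2 + t ≤ k * (L r + 1)` for all `r`. -/
lemma exists_lengths_kraft_eq_one (k : ℕ) (hk : 1 ≤ k) :
    ∃ (t : ℕ) (L : Fin k × Fin k → ℕ),
      (∀ r, k * L r ≤ r.1 + r.2 + t ∧ r.1 + r.2 + t ≤ k * L r + k) ∧
      ∑ r, (2⁻¹ : ℝ) ^ L r = 1 := by
  classical
  -- For the least `t` with `F t ≤ 1`, the floor lengths for `t` may undershoot Kraft sum one while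
  -- those for `t - 1` overshoot it. Both choices satisfy the bounds for `t`, so it suffices to
  -- revert a suitable subset of the symbols to `t - 1`.
  set F : ℕ → ℝ := fun t => ∑ r : Fin k × Fin k, (2⁻¹ : ℝ) ^ ((r.1 + r.2 + t : ℕ) / k) with hF
  have hfloor : ∀ m, k * (m / k) ≤ m ∧ m < k * (m / k) + k := fun m =>
    ⟨Nat.mul_div_le m k, by have := Nat.div_add_mod m k; have := Nat.mod_lt m hk; omega⟩
  have hex : ∃ t, F t ≤ 1 := by
    refine ⟨k * (k * k), ?_⟩
    have hb : F (k * (k * k)) ≤ ∑ _r : Fin k × Fin k, (2⁻¹ : ℝ) ^ (k * k) := by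
      refine Finset.sum_le_sum fun r _ => pow_le_pow_of_le_one (by norm_num) (by norm_num) ?_
      rw [Nat.add_mul_div_left _ _ hk]
      exact Nat.le_add_left _ _
    refine hb.trans ?_
    simp only [Finset.sum_const, Finset.card_univ, Fintype.card_prod, Fintype.card_fin,
      nsmul_eq_mul, inv_pow]
    rw [← div_eq_mul_inv, div_le_one (by positivity)]
    exact_mod_cast Nat.lt_two_pow_self.le
  set t := Nat.find hex with ht
  have hFt : F t ≤ 1 := Nat.find_spec hex
  -- There is no `t - 1` here, but the symbol `(0, 0)` alone already contributes one.
  rcases Nat.eq_zero_or_pos t with ht0 | htpos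
  · refine ⟨0, fun r => (r.1 + r.2 + 0 : ℕ) / k, fun r => ⟨(hfloor _).1, (hfloor _).2.le⟩, ?_⟩
    rw [ht0] at hFt
    refine le_antisymm hFt ?_
    have := Finset.single_le_sum (f := fun r : Fin k × Fin k =>
      (2⁻¹ : ℝ) ^ ((r.1 + r.2 + 0 : ℕ) / k)) (fun _ _ => by positivity)
      (Finset.mem_univ (⟨0, hk⟩, ⟨0, hk⟩))
    simpa using this
  have hFt' : 1 < F (t - 1) := not_le.1 (Nat.find_min hex (by omega))
  -- `s₀` is the residue with `k ∣ s₀ + t`, and `e` the largest length that occurs.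
  obtain ⟨s₀, e, hs₀, he⟩ : ∃ s₀ e, s₀ < k ∧ s₀ + t + k = k * e := by
    refine ⟨k * ((t + k - 1) / k) - t, (t + k - 1) / k + 1, ?_, ?_⟩
    · have := hfloor (t + k - 1); omega
    · have := hfloor (t + k - 1)
      rw [mul_add]; omega
  have hs : ∀ r : Fin k × Fin k, (r.1 : ℕ) + r.2 ≤ 2 * k - 2 := fun r => by
    have := r.1.2; have := r.2.2; omega
  have hle : ∀ r : Fin k × Fin k, (r.1 + r.2 + t : ℕ) / k ≤ e := fun r => by
    rw [← Nat.lt_succ_iff, Nat.div_lt_iff_lt_mul hk, Nat.succ_mul, mul_comm e, ← he]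
    have := hs r; omega
  -- `D` holds the symbols whose length changes between `t - 1` and `t`; `f` gives the Kraft terms
  -- in units of `2⁻ᵉ`. Reverting a symbol of `D` doubles its term, so the target is a subset of `D`
  -- with `f`-sum `2 ^ e - ∑ r, f r`.
  set D := (Finset.univ : Finset (Fin k × Fin k)).filter fun r => k ∣ r.1 + r.2 + t with hD
  set f : Fin k × Fin k → ℕ := fun r => 2 ^ (e - (r.1 + r.2 + t : ℕ) / k) with hf
  have hfreal : ∀ r, (2⁻¹ : ℝ) ^ ((r.1 + r.2 + t : ℕ) / k) = f r * 2⁻¹ ^ e := fun r => by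
    have h2 : (2 : ℝ) ≠ 0 := two_ne_zero
    simp only [hf, Nat.cast_pow, Nat.cast_ofNat, inv_pow]
    rw [pow_sub₀ _ h2 (hle r)]
    field_simp
  have hpos : (0 : ℝ) < 2⁻¹ ^ e := by positivity
  have h2e : ((2 ^ e : ℕ) : ℝ) * 2⁻¹ ^ e = 1 := by
    push_cast
    rw [← mul_pow]; norm_num
  have hprev : ∀ r : Fin k × Fin k, (r.1 + r.2 + (t - 1) : ℕ) / k + (if r ∈ D then 1 else 0) =
      (r.1 + r.2 + t : ℕ) / k := fun r => by
    have h := Nat.succ_div (a := (r.1 : ℕ) + r.2 + (t - 1)) (b := k)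
    rw [show (r.1 : ℕ) + r.2 + (t - 1) + 1 = r.1 + r.2 + t by omega] at h
    simp [h, hD]
  have hlower : ∀ B ⊆ D, ∑ r : Fin k × Fin k, (2⁻¹ : ℝ) ^
      (if r ∈ B then (r.1 + r.2 + (t - 1) : ℕ) / k else (r.1 + r.2 + t : ℕ) / k) =
      ((∑ r, f r + ∑ r ∈ B, f r : ℕ) : ℝ) * 2⁻¹ ^ e := by
    intro B hB
    push_cast
    rw [add_mul, Finset.sum_mul, Finset.sum_mul, ← Finset.sum_filter_add_sum_filter_not _ (· ∈ B),
      ← Finset.sum_filter_add_sum_filter_not Finset.univ (· ∈ B) (fun r => (f r : ℝ) * 2⁻¹ ^ e)]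
    have hBu : Finset.univ.filter (· ∈ B) = B := by ext; simp
    have h1 : ∑ r ∈ Finset.univ.filter (· ∈ B), (2⁻¹ : ℝ) ^
        (if r ∈ B then (r.1 + r.2 + (t - 1) : ℕ) / k else (r.1 + r.2 + t : ℕ) / k) =
        ∑ r ∈ B, (f r : ℝ) * 2⁻¹ ^ e + ∑ r ∈ B, (f r : ℝ) * 2⁻¹ ^ e := by
      rw [hBu, ← Finset.sum_add_distrib]
      refine Finset.sum_congr rfl fun r hr => ?_
      have h := hprev r
      rw [if_pos (hB hr)] at h
      rw [if_pos hr, ← hfreal, ← h, pow_succ]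
      ring
    have h2 : ∑ r ∈ Finset.univ.filter (· ∉ B), (2⁻¹ : ℝ) ^
        (if r ∈ B then (r.1 + r.2 + (t - 1) : ℕ) / k else (r.1 + r.2 + t : ℕ) / k) =
        ∑ r ∈ Finset.univ.filter (· ∉ B), (f r : ℝ) * 2⁻¹ ^ e := by
      refine Finset.sum_congr rfl fun r hr => ?_
      rw [if_neg (Finset.mem_filter.1 hr).2, hfreal]
    rw [h1, h2, hBu]
    ring
  have hNle : ∑ r, f r ≤ 2 ^ e := by
    have h : F t = ((∑ r, f r : ℕ) : ℝ) * 2⁻¹ ^ e := by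
      simp only [hF, hfreal]
      push_cast
      rw [Finset.sum_mul]
    rw [h, ← h2e] at hFt
    exact_mod_cast le_of_mul_le_mul_right hFt hpos
  have hNlt : 2 ^ e < ∑ r, f r + ∑ r ∈ D, f r := by
    have h : F (t - 1) = ((∑ r, f r + ∑ r ∈ D, f r : ℕ) : ℝ) * 2⁻¹ ^ e := by
      rw [← hlower D subset_rfl]
      refine Finset.sum_congr rfl fun r _ => ?_
      have h := hprev r
      split_ifs at h ⊢
      · rfl
      · rw [← h, add_zero]
    rw [h, ← h2e] at hFt'
    exact_mod_cast lt_of_mul_lt_mul_right hFt' hpos.le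
  have hf1 : ∀ r, e ≤ (r.1 + r.2 + t : ℕ) / k → f r = 1 := fun r h => by
    simp [hf, Nat.sub_eq_zero_of_le h]
  have hepos : 0 < e := by
    rcases Nat.eq_zero_or_pos e with h | h
    · subst h; omega
    · exact h
  -- As `r.1 + r.2` ranges over `0, …, 2k - 2`, the only possible multiples of `k` are `s₀ + t` and
  -- `s₀ + t + k = k * e`.
  have hfD : ∀ r ∈ D, f r = 1 ∨ f r = 2 := by
    intro r hr
    have hdvd : k ∣ r.1 + r.2 + t := (Finset.mem_filter.1 hr).2
    by_cases h : e ≤ (r.1 + r.2 + t : ℕ) / k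
    · exact Or.inl (hf1 r h)
    · right
      have h1 : e - 1 ≤ (r.1 + r.2 + t : ℕ) / k := by
        obtain ⟨c, hc⟩ := hdvd
        rw [hc, Nat.mul_div_cancel_left _ hk]
        by_contra hlt
        have : k * (c + 2) ≤ k * e := Nat.mul_le_mul_left k (by omega)
        rw [← he, mul_add, ← hc] at this
        omega
      have h2 : e - (r.1 + r.2 + t : ℕ) / k = 1 := by omega
      simp only [hf]
      rw [h2, pow_one]
  -- Every `f r` is a power of two, so an odd deficit forces some term to equal one, hence some
  -- symbol with coordinate sum at least `s₀ + k`. Then `s₀ + 1 < k`, and `(k - 1, s₀ + 1)` has sum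
  -- exactly `s₀ + k`, so it lies in `D` with term one.
  have hodd : Odd (2 ^ e - ∑ r, f r) → ∃ r ∈ D, f r = 1 := by
    intro ho
    have hsum : Odd (∑ r, f r) := by
      have h2 : Even (2 ^ e) := (Nat.even_pow.2 ⟨even_two, hepos.ne'⟩)
      by_contra hn
      exact Nat.not_odd_iff_even.2 ((Nat.even_sub hNle).2
        (iff_of_true h2 (Nat.not_odd_iff_even.1 hn))) ho
    obtain ⟨r, hr⟩ : ∃ r : Fin k × Fin k, e ≤ (r.1 + r.2 + t : ℕ) / k := by
      by_contra! hn
      refine Nat.not_even_iff_odd.2 hsum (Finset.even_sum _ fun r _ => ?_)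
      exact Nat.even_pow.2 ⟨even_two, by have := hn r; omega⟩
    have hr' : k * e ≤ r.1 + r.2 + t := by
      rw [mul_comm]; exact (Nat.le_div_iff_mul_le hk).1 hr
    have hlt : s₀ + 1 < k := by have := hs r; omega
    have heq : k - 1 + (s₀ + 1) + t = k * e := by omega
    refine ⟨(⟨k - 1, by omega⟩, ⟨s₀ + 1, hlt⟩), ?_, hf1 _ ?_⟩
    · rw [hD, Finset.mem_filter]
      exact ⟨Finset.mem_univ _, e, heq⟩
    · change e ≤ (k - 1 + (s₀ + 1) + t) / k
      rw [heq, Nat.mul_div_cancel_left _ hk]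
  obtain ⟨B, hB, hBsum⟩ := exists_subset_sum_eq hfD (m := 2 ^ e - ∑ r, f r) (by omega) hodd
  refine ⟨t, fun r => if r ∈ B then (r.1 + r.2 + (t - 1) : ℕ) / k else (r.1 + r.2 + t : ℕ) / k,
    fun r => ?_, ?_⟩
  · dsimp only
    split_ifs with hr
    · have := hfloor (r.1 + r.2 + (t - 1)); omega
    · exact ⟨(hfloor _).1, (hfloor _).2.le⟩
  · rw [hlower B hB, hBsum, Nat.add_sub_cancel' hNle, h2e]

/-! ### Cost and Kraft sum of block codes -/

lemma tsum_eq_tsum_block (k : ℕ) (hk : 1 ≤ k) (g : ℕ × ℕ → ℝ≥0∞) :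
    ∑' x, g x = ∑' r, ∑' a, ∑' b, g ((blockEquiv k hk).symm ((r, a), b)) := by
  rw [← (blockEquiv k hk).symm.tsum_eq,
    ← ENNReal.tsum_prod (f := fun r a => ∑' b, g ((blockEquiv k hk).symm ((r, a), b))),
    ← ENNReal.tsum_prod (f := fun u b => g ((blockEquiv k hk).symm (u, b)))]

/-- The cost of a block code depends on the lengths of the top code only through the cost of the
top code. -/
lemma tsum_block_eq (k : ℕ) (hk : 1 ≤ k) {q : ℝ} (hq0 : 0 ≤ q) (m : Fin k × Fin k → ℕ) :
    ∑' x : ℕ × ℕ, ENNReal.ofReal (tdgd q x) *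
        ((m (blockEquiv k hk x).1.1 + (x.1 / k + 1) + (x.2 / k + 1) : ℕ) : ℝ≥0∞) =
      (∑' r, ENNReal.ofReal (topWeight q k r) * (m r : ℝ≥0∞)) *
        (∑' a : ℕ, ∑' b : ℕ, ENNReal.ofReal ((1 - q) ^ 2 * q ^ (k * a + k * b))) +
      (∑' r, ENNReal.ofReal (topWeight q k r)) *
        (∑' a : ℕ, ∑' b : ℕ, ENNReal.ofReal ((1 - q) ^ 2 * q ^ (k * a + k * b)) *
          ((a + 1 + (b + 1) : ℕ) : ℝ≥0∞)) := by
  rw [tsum_eq_tsum_block k hk,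
    ← ENNReal.tsum_mul_right, ← ENNReal.tsum_mul_right, ← ENNReal.tsum_add]
  refine tsum_congr fun r => ?_
  rw [← ENNReal.tsum_mul_left, ← ENNReal.tsum_mul_left, ← ENNReal.tsum_add]
  refine tsum_congr fun a => ?_
  rw [← ENNReal.tsum_mul_left, ← ENNReal.tsum_mul_left, ← ENNReal.tsum_add]
  refine tsum_congr fun b => ?_
  -- The weight factors into a residue part and a quotient part, while the length is a sum of such
  -- parts; this separates the series.
  have hw : tdgd q ((blockEquiv k hk).symm ((r, a), b)) =
      topWeight q k r * ((1 - q) ^ 2 * q ^ (k * a + k * b)) := by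
    simp only [tdgd, geom, topWeight, blockEquiv, Equiv.coe_fn_symm_mk]
    ring
  have hx := (blockEquiv k hk).apply_symm_apply ((r, a), b)
  have ha : ((blockEquiv k hk).symm ((r, a), b)).1 / k = a :=
    congrArg (fun y => y.1.2) hx
  have hb : ((blockEquiv k hk).symm ((r, a), b)).2 / k = b :=
    congrArg (fun y => y.2) hx
  rw [hw, hx, ha, hb, ENNReal.ofReal_mul (by unfold topWeight; positivity)]
  push_cast
  ring

lemma cost_blockCode (k : ℕ) (hk : 1 ≤ k) (q : ℝ) (T : Fin k × Fin k → List Bool) :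
    cost (tdgd q) (blockCode k hk T) = ∑' x : ℕ × ℕ, ENNReal.ofReal (tdgd q x) *
      (((T (blockEquiv k hk x).1.1).length + (x.1 / k + 1) + (x.2 / k + 1) : ℕ) : ℝ≥0∞) := by
  refine tsum_congr fun x => ?_
  simp only [blockCode, List.length_append, length_unary]
  rfl

/-- Extending the codewords of a complete code by two unary codewords gives a complete code. -/
lemma tsum_kraft_block_eq_one (k : ℕ) (hk : 1 ≤ k) {L : Fin k × Fin k → ℕ}
    (hL : ∑ r, (2⁻¹ : ℝ) ^ L r = 1) :
    ∑' x : ℕ × ℕ, ENNReal.ofReal ((2⁻¹ : ℝ) ^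
      (L (blockEquiv k hk x).1.1 + (x.1 / k + 1) + (x.2 / k + 1))) = 1 := by
  have hgeom : ∑' n : ℕ, ENNReal.ofReal ((2⁻¹ : ℝ) ^ (n + 1)) = 1 := by
    have h : ∀ n : ℕ, ENNReal.ofReal ((2⁻¹ : ℝ) ^ (n + 1)) = (2⁻¹ : ℝ≥0∞) ^ (n + 1) := fun n => by
      rw [ENNReal.ofReal_pow (by norm_num), ENNReal.ofReal_inv_of_pos two_pos,
        ENNReal.ofReal_ofNat]
    simp_rw [h]
    rw [ENNReal.tsum_geometric_add_one, ENNReal.one_sub_inv_two, inv_inv]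
    exact ENNReal.inv_mul_cancel two_ne_zero ENNReal.ofNat_ne_top
  rw [tsum_eq_tsum_block k hk]
  calc ∑' r, ∑' a, ∑' b, _
      = ∑' r, ∑' a : ℕ, ∑' b : ℕ, ENNReal.ofReal ((2⁻¹ : ℝ) ^ L r) *
          ENNReal.ofReal ((2⁻¹ : ℝ) ^ (a + 1)) * ENNReal.ofReal ((2⁻¹ : ℝ) ^ (b + 1)) := by
        refine tsum_congr fun r => tsum_congr fun a => tsum_congr fun b => ?_
        have hx := (blockEquiv k hk).apply_symm_apply ((r, a), b)
        have ha : ((blockEquiv k hk).symm ((r, a), b)).1 / k = a :=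
          congrArg (fun y => y.1.2) hx
        have hb : ((blockEquiv k hk).symm ((r, a), b)).2 / k = b :=
          congrArg (fun y => y.2) hx
        rw [hx, ha, hb, ← ENNReal.ofReal_mul (by positivity), ← ENNReal.ofReal_mul (by positivity),
          pow_add, pow_add]
    _ = ∑' r, ENNReal.ofReal ((2⁻¹ : ℝ) ^ L r) := by
        simp_rw [ENNReal.tsum_mul_left, hgeom, mul_one, ENNReal.tsum_mul_left, hgeom, mul_one]
    _ = 1 := by
        rw [tsum_fintype, ← ENNReal.ofReal_sum_of_nonneg fun _ _ => by positivity, hL,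
          ENNReal.ofReal_one]

end TDGDCode

/-! ### Optimality on both sources -/

open TDGDCode

theorem theorem2 (k : ℕ) (hk : 1 ≤ k) (q : ℝ) (hq : q = (2 : ℝ) ^ (-(1 : ℝ) / (k : ℝ))) :
    (∃ T : Fin k × Fin k → List Bool, TDGDCode.IsOptimalCode (TDGDCode.topWeight q k) T) ∧
    ∀ T : Fin k × Fin k → List Bool,
      TDGDCode.IsOptimalCode (TDGDCode.topWeight q k) T →
        TDGDCode.IsOptimalCode (TDGDCode.tdgd q) (TDGDCode.blockCode k hk T) := by
  have hk0 : (k : ℝ) ≠ 0 := by exact_mod_cast (by omega : k ≠ 0)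
  have hq0 : 0 < q := hq ▸ Real.rpow_pos_of_pos two_pos _
  have hqk : q ^ k = 2⁻¹ := by
    rw [hq, ← Real.rpow_natCast, ← Real.rpow_mul two_pos.le, div_mul_cancel₀ _ hk0,
      Real.rpow_neg_one]
  have hq1 : q ≤ 1 := by
    by_contra! h
    have := one_le_pow₀ h.le (n := k)
    norm_num [hqk] at this
  have hpow : ∀ n, (2⁻¹ : ℝ) ^ n = q ^ (k * n) := fun n => by rw [pow_mul, hqk]
  obtain ⟨t, L, hL, hsum⟩ := exists_lengths_kraft_eq_one k hk
  have hw : ∀ r, 0 ≤ topWeight q k r := fun r => by unfold topWeight; positivity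
  have hw' : ∀ x, 0 ≤ tdgd q x := fun x =>
    mul_nonneg (mul_nonneg (sub_nonneg.2 hq1) (by positivity))
      (mul_nonneg (sub_nonneg.2 hq1) (by positivity))
  have hqt : 0 < q ^ t := by positivity
  have h1 : ∀ r, topWeight q k r ≤ (q ^ t)⁻¹ * 2⁻¹ ^ L r := fun r => by
    rw [hpow, inv_mul_eq_div, le_div_iff₀ hqt, topWeight, ← pow_add]
    exact pow_le_pow_of_le_one hq0.le hq1 (hL r).1
  have h2 : ∀ r, (q ^ t)⁻¹ * 2⁻¹ ^ L r ≤ 2 * topWeight q k r := fun r => by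
    have h : q ^ (k * L r) * 2⁻¹ ≤ q ^ ((r.1 : ℕ) + r.2) * q ^ t := by
      rw [← hqk, ← pow_add, ← pow_add]
      exact pow_le_pow_of_le_one hq0.le hq1 (hL r).2
    rw [hpow, inv_mul_eq_div, div_le_iff₀ hqt, topWeight]
    linarith
  have hopt : ∀ C, IsPrefixCode C →
      ∑' r, ENNReal.ofReal (topWeight q k r) * (L r : ℝ≥0∞) ≤ cost (topWeight q k) C := by
    intro C hC
    refine tsum_le_cost_of_lagrangian hw (inv_nonneg.2 hqt.le) ?_
      (fun r => lagrangian_le (hw r) (h1 r) (h2 r)) hC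
    rw [tsum_fintype, ← ENNReal.ofReal_sum_of_nonneg fun _ _ => by positivity, hsum,
      ENNReal.ofReal_one]
  obtain ⟨T₀, hT₀, hlen⟩ := exists_isPrefixCode_length_eq L hsum.le
  have hcost₀ : cost (topWeight q k) T₀ =
      ∑' r, ENNReal.ofReal (topWeight q k r) * (L r : ℝ≥0∞) := by
    simp only [cost, hlen]
  refine ⟨⟨T₀, hT₀, fun C hC => hcost₀.trans_le (hopt C hC)⟩, fun T hT =>
    ⟨blockCode_isPrefixCode hk hT.isPrefixCode, fun C hC => ?_⟩⟩
  have hcostT : ∑' r, ENNReal.ofReal (topWeight q k r) * ((T r).length : ℝ≥0∞) =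
      ∑' r, ENNReal.ofReal (topWeight q k r) * (L r : ℝ≥0∞) :=
    le_antisymm ((hT.cost_le T₀ hT₀).trans_eq hcost₀) (hopt T hT.isPrefixCode)
  -- Equal top cost allows replacing the lengths of `T` by `L`, so only `L` has to satisfy the Kraft
  -- equality and the sandwich.
  rw [cost_blockCode, tsum_block_eq k hk hq0.le fun r => (T r).length, hcostT,
    ← tsum_block_eq k hk hq0.le L]
  -- The top multiplier `q⁻ᵗ`, rescaled: `4` offsets the final zeros of the two unary words, and `(1
  -- - q) ^ 2` is the normalization of the distribution.
  set c := 4 * (1 - q) ^ 2 * (q ^ t)⁻¹ with hc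
  have hweight : ∀ x, tdgd q x = (1 - q) ^ 2 * 2⁻¹ ^ (x.1 / k + x.2 / k) *
      topWeight q k (blockEquiv k hk x).1.1 := fun x => by
    have hx : x.1 + x.2 = k * (x.1 / k + x.2 / k) + (x.1 % k + x.2 % k) := by
      have := Nat.div_add_mod x.1 k
      have := Nat.div_add_mod x.2 k
      rw [mul_add]; omega
    have hwt : topWeight q k (blockEquiv k hk x).1.1 = q ^ (x.1 % k + x.2 % k) := rfl
    rw [hwt, hpow, mul_assoc, ← pow_add, ← hx, tdgd, geom, geom]
    ring
  have hscale : ∀ x : ℕ × ℕ, c * 2⁻¹ ^ (L (blockEquiv k hk x).1.1 + (x.1 / k + 1) + (x.2 / k + 1)) =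
      (1 - q) ^ 2 * 2⁻¹ ^ (x.1 / k + x.2 / k) *
        ((q ^ t)⁻¹ * 2⁻¹ ^ L (blockEquiv k hk x).1.1) := fun x => by
    rw [hc]
    ring
  refine tsum_le_cost_of_lagrangian hw' (c := c) (by positivity)
    (tsum_kraft_block_eq_one k hk hsum) (fun x => lagrangian_le (hw' x) ?_ ?_) hC
  · rw [hscale, hweight]
    exact mul_le_mul_of_nonneg_left (h1 _) (by positivity)
  · rw [hscale, hweight, mul_left_comm (2 : ℝ)]
    exact mul_le_mul_of_nonneg_left (h2 _) (by positivity)
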